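/- Let $\mathcal H$ be a separable infinite-dimensional complex Hilbert space and let $a>0$. Let $X_a$ be the set of all self-adjoint operators $A$ on $\mathcal H$ with $\|A\|\le a$, equipped with the strong operator topology (the topology of pointwise convergence on $\mathcal H$). Then there is a dense $G_\delta$ subset $S$ of $X_a$ such that every $A\in S$ has spectrum $\operatorname{spec}(A)=[-a,a]$ and this spectrum is purely singular continuous; that is, for every $\psi\in\mathcal H$ the spectral measure $\mu_A^\psi$ of $A$ at $\psi$ (the finite Borel measure on $\mathbb R$ with $\int f\,d\mu_A^\psi=\langle\psi,f(A)\psi\rangle$ for all continuous compactly supported $f:\mathbb R\to\mathbb R$) has no atoms and is singular with respect to Lebesgue measure. -/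

import Mathlib

open scoped CompactlySupported

noncomputable section

variable {H : Type*} [NormedAddCommGroup H] [InnerProductSpace ℂ H] [CompleteSpace H]

/-- The positive linear functional `f ↦ ⟪ψ, f(A) ψ⟫` on `C_c(ℝ, ℝ)`, where `f(A)` is given by the
continuous functional calculus of the self-adjoint operator `A`. (`f(A)` is self-adjoint, so
the inner product is real. If `A` is not self-adjoint, this is the zero functional.) -/
def spectralFunctional (A : H →L[ℂ] H) (ψ : H) : C_c(ℝ, ℝ) →ₚ[ℝ] ℝ :=
  PositiveLinearMap.mk₀
    { toFun := fun f => (inner ℂ ψ (cfc (fun x : ℝ => f x) A ψ)).re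
      map_add' := fun f g => by
        have h : cfc (fun x : ℝ => (f + g) x) A
            = cfc (fun x : ℝ => f x) A + cfc (fun x : ℝ => g x) A :=
          cfc_add A _ _ f.continuous.continuousOn g.continuous.continuousOn
        rw [h]
        simp
      map_smul' := fun c f => by
        have h : cfc (fun x : ℝ => (c • f) x) A = c • cfc (fun x : ℝ => f x) A :=
          cfc_smul c _ A f.continuous.continuousOn
        rw [h, smul_apply, RCLike.real_smul_eq_coe_smul (K := ℂ),
          inner_smul_right]
        simp }
    (fun f hf => by
      have h : 0 ≤ cfc (fun x : ℝ => f x) A := cfc_nonneg fun x _ => hf x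
      exact ((ContinuousLinearMap.nonneg_iff_isPositive _).1 h).re_inner_nonneg_right ψ)

/-- The spectral measure of the self-adjoint operator `A` at the vector `ψ`: the Borel measure `μ`
on `ℝ` with `∫ f dμ = ⟪ψ, f(A) ψ⟫`, obtained from the Riesz–Markov–Kakutani theorem. -/
def spectralMeasure (A : H →L[ℂ] H) (ψ : H) : MeasureTheory.Measure ℝ :=
  RealRMK.rieszMeasure (spectralFunctional A ψ)

theorem integral_spectralMeasure (A : H →L[ℂ] H) (ψ : H) (f : C_c(ℝ, ℝ)) :
    ∫ x, f x ∂(spectralMeasure A ψ) = (inner ℂ ψ (cfc (fun x : ℝ => f x) A ψ)).re :=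
  RealRMK.integral_rieszMeasure (spectralFunctional A ψ) f

/-- A measure on `ℝ` is (purely) singular continuous if it has no atoms and is singular with respect
to Lebesgue measure. -/
def IsSingularContinuous (μ : MeasureTheory.Measure ℝ) : Prop :=
  (∀ x : ℝ, μ {x} = 0) ∧ μ.MutuallySingular MeasureTheory.volume

/-- The self-adjoint operator `A` has purely singular continuous spectrum: all of its spectral
measures are singular continuous. -/
def HasPurelySingularContinuousSpectrum (A : H →L[ℂ] H) : Prop :=
  ∀ ψ : H, IsSingularContinuous (spectralMeasure A ψ)

variable (H) in
/-- The space `X_a` of self-adjoint operators on `H` of norm at most `a`. It is a type of its own,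
so that it does not inherit the norm topology. -/
def SelfAdjointBall (a : ℝ) : Type _ :=
  {A : H →L[ℂ] H // IsSelfAdjoint A ∧ ‖A‖ ≤ a}

/-- The operator underlying an element of `X_a`. -/
def SelfAdjointBall.op {a : ℝ} (A : SelfAdjointBall H a) : H →L[ℂ] H := Subtype.val A

/-- The strong operator topology on `X_a`, that is, the topology of pointwise convergence. -/
instance SelfAdjointBall.instTopologicalSpace (a : ℝ) : TopologicalSpace (SelfAdjointBall H a) :=
  TopologicalSpace.induced
    (fun A => ContinuousLinearMap.toPointwiseConvergenceCLM ℂ (RingHom.id ℂ) H H A.op)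
    inferInstance

end

open Filter Topology Set MeasureTheory

/-! The proof is a Baire category argument. Evaluation along a dense sequence of `H` makes $X_a$ a
closed subspace of $H^{\mathbb N}$, hence completely metrizable. The desired properties follow from
countably many conditions: small atoms at `ψ` (`smallAtoms`), near-singularity at `ψ`
(`nearlySingular`), and approximate eigenvectors at `c` (`approxEigenvalue`), with `ψ` and `c` in
dense sequences and tolerance $1/(k+1)$. They are open because $A \mapsto f(A)x$ is strongly
continuous on the ball (`continuous_cfc_apply`).

They are dense because a strong neighbourhood constrains an operator at finitely many vectors only:
it contains every operator of the ball with suitable prescribed eigenvalues on some finite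
orthonormal family whose span contains `ψ` (`exists_orthonormal_of_mem_nhds`). Such an operator has
a finitely supported, hence singular, spectral measure at `ψ`. On a unit vector orthogonal to the
family any eigenvalue in $[-a,a]$ may be added. Finally, infinite dimension lets each eigenvector be
written as a normalized sum of `M` orthonormal pieces, and slightly separating the eigenvalues of
the pieces divides the atoms (`dense_smallAtoms`). -/

namespace SelfAdjointBall

variable {H : Type*} [NormedAddCommGroup H] [InnerProductSpace ℂ H] [CompleteSpace H] {a : ℝ}

/-! ### The strong topology on the ball and its Baire property -/

theorem isSelfAdjoint_op (A : SelfAdjointBall H a) : IsSelfAdjoint A.op := A.2.1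

theorem norm_op_le (A : SelfAdjointBall H a) : ‖A.op‖ ≤ a := A.2.2

theorem norm_op_apply_le (A : SelfAdjointBall H a) (x : H) : ‖A.op x‖ ≤ a * ‖x‖ :=
  A.op.le_of_opNorm_le A.norm_op_le x

theorem tendsto_iff {ι : Type*} {l : Filter ι} {B : ι → SelfAdjointBall H a}
    {A : SelfAdjointBall H a} :
    Tendsto B l (𝓝 A) ↔ ∀ x, Tendsto (fun i => (B i).op x) l (𝓝 (A.op x)) := by
  rw [nhds_induced, tendsto_comap_iff, PointwiseConvergenceCLM.tendsto_iff_forall_tendsto]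
  rfl

theorem continuous_op_apply (x : H) : Continuous fun A : SelfAdjointBall H a => A.op x :=
  continuous_iff_continuousAt.2 fun _ => tendsto_iff.1 tendsto_id x

/-- On the ball, pointwise convergence need only be tested on a dense sequence. -/
theorem tendsto_of_denseRange {ι κ : Type*} {l : Filter ι} {B : ι → SelfAdjointBall H a}
    {A : SelfAdjointBall H a} {d : κ → H} (hd : DenseRange d)
    (h : ∀ n, Tendsto (fun i => (B i).op (d n)) l (𝓝 (A.op (d n)))) : Tendsto B l (𝓝 A) := by
  refine tendsto_iff.2 fun x => Metric.tendsto_nhds.2 fun ε hε => ?_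
  have ha : 0 ≤ a := (norm_nonneg _).trans A.norm_op_le
  -- The two outer terms below cost at most `2 * a * ‖x - d n‖`; the `+ 1` leaves a positive
  -- remainder of `ε` for the middle one, even when `a = 0`.
  obtain ⟨n, hn⟩ := hd.exists_dist_lt x (ε := ε / (2 * a + 1)) (by positivity)
  rw [dist_eq_norm, lt_div_iff₀ (by positivity)] at hn
  have hlim := Metric.tendsto_nhds.1 (h n) (ε - 2 * a * ‖x - d n‖)
    (by nlinarith [norm_nonneg (x - d n)])
  filter_upwards [hlim] with i hi
  rw [dist_eq_norm] at hi ⊢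
  have e : (B i).op x - A.op x
      = (B i).op (x - d n) + ((B i).op (d n) - A.op (d n)) - A.op (x - d n) := by
    simp only [map_sub]; abel
  have h1 := (B i).norm_op_apply_le (x - d n)
  have h2 := A.norm_op_apply_le (x - d n)
  rw [e]
  calc _ ≤ ‖(B i).op (x - d n)‖ + ‖(B i).op (d n) - A.op (d n)‖ + ‖A.op (x - d n)‖ :=
        (norm_sub_le _ _).trans (by gcongr; exact norm_add_le _ _)
    _ < ε := by linarith

theorem cauchySeq_op_apply {B : ℕ → SelfAdjointBall H a} {κ : Type*} {d : κ → H}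
    (hd : DenseRange d) (h : ∀ n, CauchySeq fun i => (B i).op (d n)) (x : H) :
    CauchySeq fun i => (B i).op x := by
  refine Metric.cauchySeq_iff'.2 fun ε hε => ?_
  have ha : 0 ≤ a := (norm_nonneg _).trans (B 0).norm_op_le
  obtain ⟨n, hn⟩ := hd.exists_dist_lt x (ε := ε / (2 * a + 1)) (by positivity)
  rw [dist_eq_norm, lt_div_iff₀ (by positivity)] at hn
  obtain ⟨N, hN⟩ := Metric.cauchySeq_iff'.1 (h n) (ε - 2 * a * ‖x - d n‖)
    (by nlinarith [norm_nonneg (x - d n)])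
  refine ⟨N, fun i hi => ?_⟩
  have hi := hN i hi
  rw [dist_eq_norm] at hi ⊢
  have e : (B i).op x - (B N).op x
      = (B i).op (x - d n) + ((B i).op (d n) - (B N).op (d n)) - (B N).op (x - d n) := by
    simp only [map_sub]; abel
  have h1 := (B i).norm_op_apply_le (x - d n)
  have h2 := (B N).norm_op_apply_le (x - d n)
  rw [e]
  calc _ ≤ ‖(B i).op (x - d n)‖ + ‖(B i).op (d n) - (B N).op (d n)‖ + ‖(B N).op (x - d n)‖ :=
        (norm_sub_le _ _).trans (by gcongr; exact norm_add_le _ _)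
    _ < ε := by linarith

/-- The common Lipschitz constant `a` turns convergence on the range of `d` into pointwise
convergence everywhere, and pointwise limits remain linear, symmetric and bounded by `a`.
Countability of the index makes the target completely metrizable, so sequences suffice for
closedness and the ball inherits the Baire property. -/
theorem isClosedEmbedding_op_apply {d : ℕ → H} (hd : DenseRange d) :
    IsClosedEmbedding fun (A : SelfAdjointBall H a) n => A.op (d n) := by
  have hcont : Continuous fun (A : SelfAdjointBall H a) n => A.op (d n) :=
    continuous_pi fun n => continuous_op_apply (d n)
  refine ⟨⟨isInducing_iff_nhds.2 fun A => le_antisymm (hcont.tendsto A).le_comap ?_,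
    fun A B hAB => ?_⟩, ?_⟩
  · exact tendsto_of_denseRange (B := id) hd fun n =>
      (tendsto_pi_nhds.1 (tendsto_comap (f := fun (A : SelfAdjointBall H a) n => A.op (d n))) n)
  · refine Subtype.ext (ContinuousLinearMap.coeFn_injective ?_)
    exact hd.equalizer A.op.continuous B.op.continuous (funext fun n => congrFun hAB n)
  · refine IsSeqClosed.isClosed fun y y₀ hy hlim => ?_
    choose B hB using hy
    obtain rfl : (fun i n => (B i).op (d n)) = y := funext hB
    rw [tendsto_pi_nhds] at hlim
    have hx (x : H) : ∃ z, Tendsto (fun i => (B i).op x) atTop (𝓝 z) :=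
      cauchySeq_tendsto_of_complete (cauchySeq_op_apply hd (fun n => (hlim n).cauchySeq) x)
    choose g hg using hx
    have hlin : ∃ L : H →ₗ[ℂ] H, ∀ x, L x = g x :=
      ⟨{ toFun := g
         map_add' := fun x y => tendsto_nhds_unique (hg (x + y))
           (by simpa using (hg x).add (hg y))
         map_smul' := fun c x => tendsto_nhds_unique (hg (c • x))
           (by simpa using (hg x).const_smul c) }, fun _ => rfl⟩
    obtain ⟨L, hL⟩ := hlin
    have ha : 0 ≤ a := (norm_nonneg _).trans (B 0).norm_op_le
    have hbd : ∀ x, ‖L x‖ ≤ a * ‖x‖ := fun x => by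
      rw [hL]
      exact le_of_tendsto (hg x).norm (Eventually.of_forall fun i => (B i).norm_op_apply_le x)
    refine ⟨⟨L.mkContinuous a hbd, ?_, L.mkContinuous_norm_le ha hbd⟩, ?_⟩
    · rw [ContinuousLinearMap.isSelfAdjoint_iff_isSymmetric]
      intro x y
      simp only [ContinuousLinearMap.coe_coe, LinearMap.mkContinuous_apply, hL]
      refine tendsto_nhds_unique ((hg x).inner tendsto_const_nhds)
        ((tendsto_const_nhds.inner (hg y)).congr fun i => ?_)
      exact ((ContinuousLinearMap.isSelfAdjoint_iff_isSymmetric.1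
        (B i).isSelfAdjoint_op) x y).symm
    · funext n
      exact (hL (d n)).trans (tendsto_nhds_unique (hg (d n)) (hlim n))

instance instBaireSpace [TopologicalSpace.SeparableSpace H] : BaireSpace (SelfAdjointBall H a) := by
  have := (isClosedEmbedding_op_apply (a := a)
    (TopologicalSpace.denseRange_denseSeq H)).IsCompletelyMetrizableSpace
  let := TopologicalSpace.upgradeIsCompletelyMetrizable (SelfAdjointBall H a)
  infer_instance

/-! ### Strong continuity of the functional calculus -/

/-- Polynomials approximate a continuous function uniformly over the functional calculi of all
operators of the ball. -/
theorem exists_polynomial_near (a : ℝ) {f : ℝ → ℝ} (hf : Continuous f) {ε : ℝ} (hε : 0 < ε) :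
    ∃ p : Polynomial ℝ, (∀ x ∈ Icc (-a) a, |p.eval x - f x| < ε) ∧
      ∀ A : SelfAdjointBall H a, ‖Polynomial.aeval A.op p - cfc f A.op‖ ≤ ε := by
  obtain ⟨p, hp⟩ := exists_polynomial_near_of_continuousOn (-a) a f hf.continuousOn ε hε
  refine ⟨p, hp, fun A => ?_⟩
  rw [← cfc_polynomial p A.op A.isSelfAdjoint_op, ← cfc_sub _ _ A.op
    p.continuous.continuousOn hf.continuousOn]
  refine norm_cfc_le hε.le fun x hx => ?_
  have hx' : ‖x‖ ≤ a := by
    cases subsingleton_or_nontrivial H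
    · simp [spectrum.of_subsingleton] at hx
    · exact (spectrum.norm_le_norm_of_mem hx).trans A.norm_op_le
  exact (hp x (abs_le.1 hx')).le

theorem continuous_aeval_apply (p : Polynomial ℝ) (x : H) :
    Continuous fun A : SelfAdjointBall H a => Polynomial.aeval A.op p x := by
  have hpow (n : ℕ) : Continuous fun A : SelfAdjointBall H a => (A.op ^ n) x := by
    induction n with
    | zero => simpa using continuous_const
    | succ n ih =>
      refine continuous_iff_continuousAt.2 fun A => ?_
      simp only [pow_succ', ContinuousAt, mul_apply_eq_comp]
      have h1 := tendsto_iff.1 (tendsto_id (x := 𝓝 A)) ((A.op ^ n) x)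
      -- Composition is strongly continuous here because the left factor is bounded by `a` uniformly
      -- in `B`.
      have h2 : Tendsto (fun B : SelfAdjointBall H a => B.op ((B.op ^ n) x - (A.op ^ n) x))
          (𝓝 A) (𝓝 0) := by
        refine squeeze_zero_norm (fun B => B.norm_op_apply_le _) ?_
        have := ((ih.tendsto A).sub_const ((A.op ^ n) x)).norm.const_mul a
        simpa using this
      simpa using h1.add h2
  have h (A : SelfAdjointBall H a) : Polynomial.aeval A.op p x
      = ∑ i ∈ Finset.range (p.natDegree + 1), p.coeff i • (A.op ^ i) x := by
    simp [Polynomial.aeval_eq_sum_range]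
  simp only [h]
  exact continuous_finsetSum _ fun i _ => (hpow i).const_smul _

/-- A uniform limit, over the whole ball, of the continuous maps given by polynomials. This is the
source of openness for the two conditions on spectral measures. -/
theorem continuous_cfc_apply {f : ℝ → ℝ} (hf : Continuous f) (x : H) :
    Continuous fun A : SelfAdjointBall H a => cfc f A.op x := by
  refine continuous_of_uniform_approx_of_continuous fun u hu => ?_
  obtain ⟨ε, hε, hεu⟩ := Metric.mem_uniformity_dist.1 hu
  obtain ⟨p, -, hp⟩ := exists_polynomial_near (H := H) a hf (ε := ε / (‖x‖ + 1)) (by positivity)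
  refine ⟨_, continuous_aeval_apply p x, fun A => hεu ?_⟩
  rw [dist_comm, dist_eq_norm, ← sub_apply]
  refine (ContinuousLinearMap.le_of_opNorm_le _ (hp A) x).trans_lt ?_
  rw [div_mul_eq_mul_div, div_lt_iff₀ (by positivity)]
  nlinarith

/-- The functional calculus acts on eigenvectors through their eigenvalue. -/
theorem cfc_apply_of_apply_eq_smul {f : ℝ → ℝ} (hf : Continuous f) (A : SelfAdjointBall H a)
    {v : H} {c : ℝ} (hc : c ∈ Icc (-a) a) (hv : A.op v = c • v) :
    cfc f A.op v = f c • v := by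
  have hpow (n : ℕ) : (A.op ^ n) v = c ^ n • v := by
    induction n with
    | zero => simp
    | succ n ih => rw [pow_succ', mul_apply_eq_comp, ih, ContinuousLinearMap.map_smul_of_tower, hv,
        smul_smul, pow_succ]
  have hpoly (p : Polynomial ℝ) : Polynomial.aeval A.op p v = p.eval c • v := by
    simp [Polynomial.aeval_eq_sum_range, Polynomial.eval_eq_sum_range, hpow, Finset.sum_smul,
      smul_smul]
  rw [← sub_eq_zero, ← norm_le_zero_iff]
  refine le_of_forall_pos_le_add fun ε hε => ?_
  -- Each of the two errors, at the scalar `c` and at the operator, is then at most `ε / 2`.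
  obtain ⟨p, hp, hpA⟩ := exists_polynomial_near (H := H) a hf
    (ε := ε / (2 * (‖v‖ + 1))) (by positivity)
  have h1 := ContinuousLinearMap.le_of_opNorm_le _ (hpA A) v
  have h2 : ‖(p.eval c - f c) • v‖ ≤ ε / (2 * (‖v‖ + 1)) * ‖v‖ := by
    rw [norm_smul]; gcongr; exact (hp c hc).le
  have e : cfc f A.op v - f c • v
      = (p.eval c - f c) • v - (Polynomial.aeval A.op p - cfc f A.op) v := by
    rw [sub_smul, sub_apply, hpoly]; abel
  have h3 : ε / (2 * (‖v‖ + 1)) * ‖v‖ ≤ ε / 2 := by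
    rw [div_mul_eq_mul_div, div_le_div_iff₀ (by positivity) (by positivity)]
    nlinarith [norm_nonneg v]
  rw [e]
  linarith [norm_sub_le ((p.eval c - f c) • v) ((Polynomial.aeval A.op p - cfc f A.op) v)]

end SelfAdjointBall

/-! ### Finite orthonormal families in infinite dimension -/

section Orthonormal

variable {H : Type*} [NormedAddCommGroup H] [InnerProductSpace ℂ H]

theorem exists_orthonormal_of_not_finiteDimensional (hH : ¬ FiniteDimensional ℂ H)
    (ι : Type*) [Fintype ι] : ∃ u : ι → H, Orthonormal ℂ u := by
  obtain ⟨s, hs, hli⟩ := exists_finset_linearIndependent_of_le_rank (R := ℂ) (M := H)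
    (n := Fintype.card ι)
    (Cardinal.natCast_le_aleph0.trans (not_lt.1 (mt Module.rank_lt_aleph0_iff.1 hH)))
  have hfin : Module.finrank ℂ (Submodule.span ℂ (s : Set H)) = Fintype.card ι := by
    rw [finrank_span_finset_eq_card hli, hs]
  let b := stdOrthonormalBasis ℂ (Submodule.span ℂ (s : Set H))
  have e : ι ≃ Fin (Module.finrank ℂ (Submodule.span ℂ (s : Set H))) :=
    (Fintype.equivFin ι).trans (finCongr hfin.symm)
  exact ⟨fun i => (b (e i) : H),
    (b.orthonormal.comp_linearIsometry (Submodule.subtypeₗᵢ _)).comp e e.injective⟩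

/-- A linear isometry of a finite-dimensional subspace containing both families carries one finite
orthonormal family to another. -/
theorem exists_linearIsometry_of_orthonormal {V : Type*} [NormedAddCommGroup V]
    [InnerProductSpace ℂ V] [FiniteDimensional ℂ V] {ι : Type*} {u v : ι → V}
    (hu : Orthonormal ℂ u) (hv : Orthonormal ℂ v) : ∃ L : V →ₗᵢ[ℂ] V, ∀ i, L (u i) = v i := by
  let b := Module.Basis.span hu.linearIndependent
  have hb (i : ι) : (b i : V) = u i :=
    congrArg Subtype.val (Module.Basis.span_apply hu.linearIndependent i)
  have hbo : Orthonormal ℂ b := by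
    rw [← (Submodule.subtypeₗᵢ _).orthonormal_comp_iff]
    convert hu using 1
    exact funext hb
  have hf : Orthonormal ℂ (b.constr ℂ v ∘ b) := by
    convert hv using 1
    funext i
    simp
  refine ⟨((b.constr ℂ v).isometryOfOrthonormal hbo hf).extend, fun i => ?_⟩
  rw [← hb, LinearIsometry.extend_apply]
  simp

theorem Orthonormal.norm_sq_sum_smul {ι : Type*} [Fintype ι] {u : ι → H}
    (hu : Orthonormal ℂ u) (l : ι → ℂ) : ‖∑ i, l i • u i‖ ^ 2 = ∑ i, ‖l i‖ ^ 2 := by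
  have h := hu.inner_sum l l Finset.univ
  rw [inner_self_eq_norm_sq_to_K] at h
  simp only [Complex.conj_mul'] at h
  refine Complex.ofReal_injective ?_
  push_cast
  exact h

/-- In an infinite-dimensional space, the vectors of a finite orthonormal family are normalized sums
of disjoint blocks of a larger orthonormal family. -/
theorem Orthonormal.exists_sum_eq_sqrt_smul (hH : ¬ FiniteDimensional ℂ H) {ι : Type*}
    [Fintype ι] {u : ι → H} (hu : Orthonormal ℂ u) {M : ℕ} (hM : 0 < M) :
    ∃ w : ι × Fin M → H, Orthonormal ℂ w ∧ ∀ i, ∑ m, w (i, m) = (√M : ℂ) • u i := by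
  obtain ⟨e, he⟩ := exists_orthonormal_of_not_finiteDimensional hH (ι × Fin M)
  -- The family `e` is unrelated to `u`. Its normalized block sums `v` are orthonormal, so an
  -- isometry taking `v` to `u` takes `e` to the required family; it is built inside the
  -- finite-dimensional `V`, where partial isometries extend.
  let V := Submodule.span ℂ (range u ∪ range e)
  have : FiniteDimensional ℂ V :=
    FiniteDimensional.span_of_finite ℂ ((finite_range u).union (finite_range e))
  let u' : ι → V := fun i => ⟨u i, Submodule.subset_span (.inl ⟨i, rfl⟩)⟩
  let e' : ι × Fin M → V := fun i => ⟨e i, Submodule.subset_span (.inr ⟨i, rfl⟩)⟩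
  have hu' : Orthonormal ℂ u' := (Submodule.subtypeₗᵢ V).orthonormal_comp_iff.1 hu
  have he' : Orthonormal ℂ e' := (Submodule.subtypeₗᵢ V).orthonormal_comp_iff.1 he
  have hM0 : (√M : ℂ) ≠ 0 := by
    exact_mod_cast (Real.sqrt_pos.2 (by exact_mod_cast hM : (0 : ℝ) < M)).ne'
  have hMM : (√M : ℂ) * √M = M := by
    exact_mod_cast Real.mul_self_sqrt (Nat.cast_nonneg M)
  let v : ι → V := fun i => (√M : ℂ)⁻¹ • ∑ m, e' (i, m)
  classical
  have hv : Orthonormal ℂ v := by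
    refine orthonormal_iff_ite.2 fun i j => ?_
    simp only [v, inner_smul_left, inner_smul_right, sum_inner, inner_sum,
      orthonormal_iff_ite.1 he', Prod.mk.injEq]
    by_cases hij : i = j
    · simp only [hij, true_and, map_inv₀, Complex.conj_ofReal]
      simp only [Finset.sum_ite_eq', Finset.mem_univ, if_true, Finset.sum_const,
        Finset.card_univ, Fintype.card_fin, nsmul_eq_mul, mul_one]
      rw [← hMM]
      field_simp
    · simp [hij]
  obtain ⟨L, hL⟩ := exists_linearIsometry_of_orthonormal hv hu'
  refine ⟨fun i => (L (e' i) : H),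
    (he'.comp_linearIsometry L).comp_linearIsometry V.subtypeₗᵢ, fun i => ?_⟩
  have h := hL i
  simp only [v, map_smul, map_sum] at h
  rw [inv_smul_eq_iff₀ hM0] at h
  simpa using congrArg Subtype.val h

end Orthonormal

/-! ### Finite-rank models inside strong neighbourhoods -/

namespace SelfAdjointBall

variable {H : Type*} [NormedAddCommGroup H] [InnerProductSpace ℂ H] [CompleteSpace H] {a : ℝ}

/-- The diagonal operator $\sum_i c_i \langle u_i,\cdot\rangle u_i$ works; Bessel's inequality
bounds its norm by `a`. -/
theorem exists_apply_eq_smul (ha : 0 ≤ a) {ι : Type*} [Fintype ι] {u : ι → H}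
    (hu : Orthonormal ℂ u) {c : ι → ℝ} (hc : ∀ i, c i ∈ Icc (-a) a) :
    ∃ A : SelfAdjointBall H a, ∀ i, A.op (u i) = c i • u i := by
  classical
  let T : H →L[ℂ] H := ∑ i, c i • InnerProductSpace.rankOne ℂ (u i) (u i)
  have hT (x : H) : T x = ∑ i, ((c i : ℂ) * inner ℂ (u i) x) • u i := by
    simp [T, _root_.sum_apply, mul_smul]
  refine ⟨⟨T, ?_, ?_⟩, fun i => ?_⟩
  · refine isSelfAdjoint_sum _ fun i _ => IsSelfAdjoint.smul (.all _) ?_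
    exact (ContinuousLinearMap.isSelfAdjoint_iff_isSymmetric).2
      (InnerProductSpace.isSymmetric_rankOne_self _)
  · refine T.opNorm_le_bound ha fun x => ?_
    refine (sq_le_sq₀ (norm_nonneg _) (by positivity)).1 ?_
    rw [hT, hu.norm_sq_sum_smul, mul_pow]
    refine le_trans ?_ (mul_le_mul_of_nonneg_left (hu.sum_inner_products_le x
      (s := Finset.univ)) (sq_nonneg a))
    rw [Finset.mul_sum]
    gcongr with i
    rw [norm_mul, mul_pow]
    gcongr
    simpa using abs_le.2 (hc i)
  · change T (u i) = _
    rw [hT]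
    simp [orthonormal_iff_ite.1 hu]

/-- A neighbourhood contains every operator with the same values at finitely many vectors. -/
theorem exists_finset_of_mem_nhds {A : SelfAdjointBall H a} {N : Set (SelfAdjointBall H a)}
    (hN : N ∈ 𝓝 A) :
    ∃ t : Finset H, ∀ B : SelfAdjointBall H a, (∀ x ∈ t, B.op x = A.op x) → B ∈ N := by
  -- Counterexamples `B t`, indexed by the directed set of finite subsets of `H`, would form a net
  -- converging to `A` outside `N`.
  by_contra! h
  choose B hB hBN using h
  have hlim : Tendsto B atTop (𝓝 A) := by
    refine tendsto_iff.2 fun x => tendsto_const_nhds.congr' ?_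
    filter_upwards [eventually_ge_atTop {x}] with t ht
    exact (hB t x (ht (Finset.mem_singleton_self x))).symm
  obtain ⟨t, ht⟩ := (hlim.eventually hN).exists
  exact hBN t ht

/-- Diagonalization of the compression of a self-adjoint operator to a finite-dimensional
subspace. -/
theorem exists_orthonormal_compression (A : SelfAdjointBall H a) (F : Submodule ℂ H)
    [FiniteDimensional ℂ F] :
    ∃ (n : ℕ) (u : Fin n → H) (c : Fin n → ℝ), Orthonormal ℂ u ∧ (∀ i, c i ∈ Icc (-a) a) ∧
      Submodule.span ℂ (range u) = F ∧ ∀ B : H →L[ℂ] H, (∀ i, B (u i) = c i • u i) →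
        ∀ x ∈ F, A.op x ∈ F → B x = A.op x := by
  -- The compression of `A` to `F` is symmetric with norm at most `a`, so it is diagonalizable with
  -- eigenvalues in `[-a, a]`, and it agrees with `A` at each `x ∈ F` with `A x ∈ F`.
  let T : F →ₗ[ℂ] F := (F.orthogonalProjectionOnto ∘L A.op ∘L F.subtypeL).toLinearMap
  have hTapp (x : F) : T x = F.orthogonalProjectionOnto (A.op x) := rfl
  have hT : T.IsSymmetric := fun x y => by
    rw [hTapp, hTapp, Submodule.inner_orthogonalProjectionOnto_eq_of_mem_left,
      Submodule.inner_orthogonalProjectionOnto_eq_of_mem_right]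
    exact (ContinuousLinearMap.isSelfAdjoint_iff_isSymmetric.1 A.isSelfAdjoint_op) x y
  let b := hT.eigenvectorBasis rfl
  let c := hT.eigenvalues rfl
  have hb (i) : T (b i) = (c i : ℂ) • b i := hT.apply_eigenvectorBasis rfl i
  refine ⟨_, fun i => (b i : H), c, b.orthonormal.comp_linearIsometry F.subtypeₗᵢ,
    fun i => abs_le.1 ?_, ?_, fun B hB x hx hAx => ?_⟩
  · have h1 : ‖T (b i)‖ = |c i| := by rw [hb, norm_smul, b.norm_eq_one]; simp
    rw [← h1, hTapp]
    refine (F.norm_orthogonalProjectionOnto_apply_le _).trans ((A.norm_op_apply_le _).trans ?_)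
    rw [← Submodule.coe_norm, b.norm_eq_one, mul_one]
  · have := congrArg (Submodule.map F.subtype) b.toBasis.span_eq
    rw [Submodule.map_span, Submodule.map_top, Submodule.range_subtype, ← range_comp] at this
    refine Eq.trans ?_ this
    congr 2
  · have h : B.toLinearMap ∘ₗ F.subtype = F.subtype ∘ₗ T := by
      refine b.toBasis.ext fun i => ?_
      simp [hb, hB]
    have h1 : B x = (T ⟨x, hx⟩ : H) := LinearMap.congr_fun h ⟨x, hx⟩
    rw [h1, hTapp]
    exact F.starProjection_eq_self_iff.2 hAx

/-- Every neighbourhood of an operator contains all operators with prescribed eigenvalues at a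
suitable finite orthonormal family, whose span contains a prescribed vector. -/
theorem exists_orthonormal_of_mem_nhds {A : SelfAdjointBall H a} {N : Set (SelfAdjointBall H a)}
    (hN : N ∈ 𝓝 A) (ψ : H) :
    ∃ (n : ℕ) (u : Fin n → H) (c : Fin n → ℝ), Orthonormal ℂ u ∧ (∀ i, c i ∈ Icc (-a) a) ∧
      ψ ∈ Submodule.span ℂ (range u) ∧
      ∀ B : SelfAdjointBall H a, (∀ i, B.op (u i) = c i • u i) → B ∈ N := by
  classical
  obtain ⟨t, ht⟩ := exists_finset_of_mem_nhds hN
  -- Including the images `A x` makes the compression agree with `A` on `t`; including `ψ` puts it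
  -- in the span of the eigenvectors.
  let s : Finset H := insert ψ (t ∪ t.image A.op)
  obtain ⟨n, u, c, hu, hc, hspan, h⟩ :=
    exists_orthonormal_compression A (Submodule.span ℂ (s : Set H))
  refine ⟨n, u, c, hu, hc, hspan ▸ Submodule.subset_span (by simp [s]), fun B hB =>
    ht B fun x hx => h B.op hB x (Submodule.subset_span ?_) (Submodule.subset_span ?_)⟩
  · simp [s, hx]
  · have : A.op x ∈ t.image A.op := Finset.mem_image_of_mem _ hx
    simp only [s, Finset.coe_insert, Finset.coe_union, mem_insert_iff, mem_union, Finset.mem_coe]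
    exact .inr (.inr this)

end SelfAdjointBall

/-! ### The three conditions: openness and density -/

theorem exists_compactlySupported_one {K O : Set ℝ} (hK : IsCompact K) (hO : IsOpen O)
    (hKO : K ⊆ O) : ∃ f : C_c(ℝ, ℝ), (∀ x, f x ∈ Icc (0 : ℝ) 1) ∧ (∀ x ∈ K, f x = 1) ∧
      ∀ x ∉ O, f x = 0 := by
  obtain ⟨f, h1, h2, h3, h4⟩ := exists_continuousMap_one_of_isCompact_subset_isOpen hK hO hKO
  exact ⟨⟨f, h2⟩, h4, h1, fun x hx => image_eq_zero_of_notMem_tsupport fun h => hx (h3 h)⟩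

namespace SelfAdjointBall

variable {H : Type*} [NormedAddCommGroup H] [InnerProductSpace ℂ H] [CompleteSpace H] {a : ℝ}

theorem continuous_spectralFunctional (ψ : H) (f : C_c(ℝ, ℝ)) :
    Continuous fun A : SelfAdjointBall H a => spectralFunctional A.op ψ f :=
  Complex.continuous_re.comp
    (continuous_const.inner (continuous_cfc_apply f.continuous ψ))

variable (a) in
/-- The operators whose spectral measure at `ψ` has small mass near each point of `[-a, a]`. -/
def smallAtoms (ψ : H) (ε : ℝ) : Set (SelfAdjointBall H a) :=
  {A | ∀ x ∈ Icc (-a) a, ∃ f : C_c(ℝ, ℝ), (∀ y, f y ∈ Icc (0 : ℝ) 1) ∧ 1 / 2 < f x ∧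
    spectralFunctional A.op ψ f < ε}

variable (a) in
/-- The operators whose spectral measure at `ψ` is, up to small mass, carried by a set of small
Lebesgue measure. -/
def nearlySingular (ψ : H) (ε : ℝ) : Set (SelfAdjointBall H a) :=
  {A | ∃ f : C_c(ℝ, ℝ), (∀ y, f y ∈ Icc (0 : ℝ) 1) ∧ ∫ x, f x < ε ∧
    ‖ψ‖ ^ 2 - spectralFunctional A.op ψ f < ε}

variable (H) in
/-- The operators with an approximate unit eigenvector at `c`. -/
def approxEigenvalue (c ε : ℝ) : Set (SelfAdjointBall H a) :=
  {A | ∃ x : H, ‖x‖ = 1 ∧ ‖A.op x - c • x‖ < ε}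

/-- A test function valid for `(A, x)` stays valid for nearby pairs, since both of its inequalities
are strict; this is why `1 / 2 < f x` replaces `f x = 1`. Compactness of `[-a, a]` then handles all
`x` at once. -/
theorem isOpen_smallAtoms (ψ : H) (ε : ℝ) : IsOpen (smallAtoms a ψ ε) := by
  refine isOpen_iff_mem_nhds.2 fun A hA =>
    isCompact_Icc.eventually_forall_of_forall_eventually fun x hx => ?_
  obtain ⟨f, hf, hfx, hfA⟩ := hA x hx
  have h1 := ((continuous_spectralFunctional ψ f).comp
    (continuous_fst (X := SelfAdjointBall H a) (Y := ℝ))).tendsto (A, x) |>.eventually_lt_const hfA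
  have h2 := (f.continuous.comp
    (continuous_snd (X := SelfAdjointBall H a) (Y := ℝ))).tendsto (A, x) |>.eventually_const_lt hfx
  filter_upwards [h1, h2] with z hz1 hz2
  exact ⟨f, hf, hz2, hz1⟩

theorem isOpen_nearlySingular (ψ : H) (ε : ℝ) : IsOpen (nearlySingular a ψ ε) := by
  have : nearlySingular a ψ ε = ⋃ f ∈ {f : C_c(ℝ, ℝ) | (∀ y, f y ∈ Icc (0 : ℝ) 1) ∧ ∫ x, f x < ε},
      {A : SelfAdjointBall H a | ‖ψ‖ ^ 2 - spectralFunctional A.op ψ f < ε} := by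
    ext A
    simp [nearlySingular, and_assoc]
  rw [this]
  exact isOpen_biUnion fun f _ =>
    isOpen_lt (continuous_const.sub (continuous_spectralFunctional ψ f)) continuous_const

theorem isOpen_approxEigenvalue (c ε : ℝ) :
    IsOpen (approxEigenvalue H c ε : Set (SelfAdjointBall H a)) := by
  have : approxEigenvalue H c ε = ⋃ x ∈ {x : H | ‖x‖ = 1},
      {A : SelfAdjointBall H a | ‖A.op x - c • x‖ < ε} := by
    ext A
    simp [approxEigenvalue]
  rw [this]
  exact isOpen_biUnion fun x _ =>
    isOpen_lt ((continuous_op_apply x).sub continuous_const).norm continuous_const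

/-- For a finite-rank model with `ψ` in the span of the prescribed eigenvectors, the spectral
measure at `ψ` lives on finitely many points. A function equal to `1` there and supported in a small
open set captures all of its mass. -/
theorem dense_nearlySingular (ha : 0 ≤ a) (ψ : H) {ε : ℝ} (hε : 0 < ε) :
    Dense (nearlySingular a ψ ε) := by
  refine fun A => mem_closure_iff_nhds.2 fun N hN => ?_
  obtain ⟨n, u, c, hu, hc, hψ, h⟩ := exists_orthonormal_of_mem_nhds hN ψ
  obtain ⟨B, hB⟩ := exists_apply_eq_smul ha hu hc
  refine ⟨B, h B hB, ?_⟩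
  obtain ⟨O, hcO, hO, hvol⟩ := (range c).exists_isOpen_lt_of_lt (μ := volume) (ENNReal.ofReal ε)
    (by rw [(finite_range c).measure_zero]; simpa using hε)
  obtain ⟨f, hf, hf1, hf0⟩ := exists_compactlySupported_one (finite_range c).isCompact hO hcO
  refine ⟨f, hf, ?_, ?_⟩
  · have hlt : volume.real O < ε := (ENNReal.lt_ofReal_iff_toReal_lt hvol.ne_top).1 hvol
    refine lt_of_le_of_lt ?_ hlt
    rw [← integral_indicator_one hO.measurableSet]
    refine integral_mono (f.continuous.integrable_of_hasCompactSupport f.hasCompactSupport)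
      ((integrable_indicator_iff hO.measurableSet).2 (integrableOn_const hvol.ne_top)) fun x => ?_
    by_cases hx : x ∈ O
    · simpa [hx] using (hf x).2
    · simp [hx, hf0 x hx]
  · have hfix : cfc (f : ℝ → ℝ) B.op ψ = ψ := by
      have : EqOn (cfc (f : ℝ → ℝ) B.op).toLinearMap (LinearMap.id (R := ℂ) (M := H))
          (Submodule.span ℂ (range u)) := by
        refine LinearMap.eqOn_span' ?_
        rintro _ ⟨i, rfl⟩
        simpa [hf1] using cfc_apply_of_apply_eq_smul f.continuous B (hc i) (hB i)
      exact this hψ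
    have : spectralFunctional B.op ψ f = ‖ψ‖ ^ 2 := by
      change (inner ℂ ψ (cfc (f : ℝ → ℝ) B.op ψ)).re = _
      rw [hfix, inner_self_eq_norm_sq_to_K]
      norm_cast
    rw [this]
    simpa using hε

/-- The neighbourhood constrains only a finite-dimensional space, so a unit vector orthogonal to it
can be given the exact eigenvalue `c`. -/
theorem dense_approxEigenvalue (hH : ¬ FiniteDimensional ℂ H) {c ε : ℝ} (hc : c ∈ Icc (-a) a)
    (hε : 0 < ε) : Dense (approxEigenvalue H c ε : Set (SelfAdjointBall H a)) := by
  have ha : 0 ≤ a := by linarith [hc.1, hc.2]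
  refine fun A => mem_closure_iff_nhds.2 fun N hN => ?_
  obtain ⟨n, u, d, hu, hd, -, h⟩ := exists_orthonormal_of_mem_nhds hN 0
  let F := Submodule.span ℂ (range u)
  have hFfin : FiniteDimensional ℂ F := FiniteDimensional.span_of_finite ℂ (finite_range u)
  have hF : Fᗮ ≠ ⊥ := fun hbot => hH <| by
    rw [Submodule.orthogonal_eq_bot_iff] at hbot
    rw [hbot] at hFfin
    exact Module.Finite.equiv Submodule.topEquiv
  obtain ⟨y, hyF, hy0⟩ := Submodule.exists_mem_ne_zero_of_ne_bot hF
  let e : H := (‖y‖⁻¹ : ℂ) • y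
  have he : ‖e‖ = 1 := norm_smul_inv_norm hy0
  have heF : e ∈ Fᗮ := Submodule.smul_mem _ _ hyF
  have hue (i) : inner ℂ (u i) e = 0 :=
    (Submodule.mem_orthogonal F e).1 heF (u i) (Submodule.subset_span ⟨i, rfl⟩)
  have hv : Orthonormal ℂ (fun o : Option (Fin n) => o.elim e u) := by
    classical
    refine orthonormal_iff_ite.2 ?_
    rintro (_ | i) (_ | j)
    · simp [inner_self_eq_norm_sq_to_K, he]
    · simpa using inner_eq_zero_symm.1 (hue j)
    · simpa using hue i
    · simpa using orthonormal_iff_ite.1 hu i j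
  obtain ⟨B, hB⟩ := exists_apply_eq_smul ha hv (c := fun o => o.elim c d) (by
    rintro (_ | i)
    exacts [hc, hd i])
  refine ⟨B, h B fun i => hB (some i), e, he, ?_⟩
  have : B.op e = c • e := hB none
  simpa [this] using hε

theorem exists_op_eq_convexCombination (A B : SelfAdjointBall H a) {t : ℝ} (ht : t ∈ Icc (0 : ℝ) 1) :
    ∃ C : SelfAdjointBall H a, C.op = (1 - t) • A.op + t • B.op := by
  refine ⟨⟨_, ?_, ?_⟩, rfl⟩
  · exact (IsSelfAdjoint.smul (.all _) A.isSelfAdjoint_op).add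
      (IsSelfAdjoint.smul (.all _) B.isSelfAdjoint_op)
  · refine (norm_add_le _ _).trans ?_
    rw [norm_smul, norm_smul, Real.norm_of_nonneg ht.1, Real.norm_of_nonneg (sub_nonneg.2 ht.2)]
    nlinarith [A.norm_op_le, B.norm_op_le, ht.1, ht.2]

theorem spectralFunctional_sum {ι : Type*} [Fintype ι] {w : ι → H} (hw : Orthonormal ℂ w)
    {A : SelfAdjointBall H a} {c : ι → ℝ} (hc : ∀ i, c i ∈ Icc (-a) a)
    (hA : ∀ i, A.op (w i) = c i • w i) (l : ι → ℂ) (f : C_c(ℝ, ℝ)) :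
    spectralFunctional A.op (∑ i, l i • w i) f = ∑ i, ‖l i‖ ^ 2 * f (c i) := by
  have h (i) : cfc (f : ℝ → ℝ) A.op (w i) = f (c i) • w i :=
    cfc_apply_of_apply_eq_smul f.continuous A (hc i) (hA i)
  change (inner ℂ _ (cfc (f : ℝ → ℝ) A.op _)).re = _
  have h' : cfc (f : ℝ → ℝ) A.op (∑ i, l i • w i) = ∑ i, (l i * f (c i)) • w i := by
    simp [h, mul_smul]
  rw [h', hw.inner_sum, Complex.re_sum]
  refine Finset.sum_congr rfl fun i _ => ?_
  rw [← mul_assoc, Complex.conj_mul']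
  norm_cast

/-- Splitting every eigenvector of a finite-rank model into `M` pieces with distinct nearby
eigenvalues makes the atoms of the spectral measure small. -/
theorem dense_smallAtoms (hH : ¬ FiniteDimensional ℂ H) (ha : 0 < a) (ψ : H) {ε : ℝ}
    (hε : 0 < ε) : Dense (smallAtoms a ψ ε) := by
  refine fun A => mem_closure_iff_nhds.2 fun N' hN' => ?_
  obtain ⟨N, hNN', hNo, hAN⟩ := mem_nhds_iff.1 hN'
  obtain ⟨n, u, c, hu, hc, hψ, h⟩ := exists_orthonormal_of_mem_nhds (hNo.mem_nhds hAN) ψ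
  -- Each block will contribute at most one of its `M` equal pieces near a given point, a total mass
  -- of at most `‖ψ‖ ^ 2 / M < ε`.
  obtain ⟨M, hM⟩ := exists_nat_gt (‖ψ‖ ^ 2 / ε)
  have hM0' : (0 : ℝ) < M := lt_of_le_of_lt (by positivity) hM
  have hM0 : 0 < M := by exact_mod_cast hM0'
  have hsqrt : (√M : ℂ) ≠ 0 := by exact_mod_cast (Real.sqrt_pos.2 hM0').ne'
  obtain ⟨w, hw, hwu⟩ := hu.exists_sum_eq_sqrt_smul hH hM0
  have hd (p : Fin n × Fin M) : a * (p.2 : ℕ) / M ∈ Icc (-a) a := by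
    have h1 : ((p.2 : ℕ) : ℝ) ≤ M := by exact_mod_cast p.2.2.le
    refine ⟨(neg_nonpos.2 ha.le).trans (by positivity), ?_⟩
    rw [div_le_iff₀ hM0']
    gcongr
  obtain ⟨B, hB⟩ := exists_apply_eq_smul ha.le hw (c := fun p => c p.1) fun p => hc p.1
  -- `B` is constant on blocks, `D` separates the pieces of each block. Convex combinations of the
  -- two stay in the ball, separate the pieces as well, and tend to `B`.
  obtain ⟨D, hD⟩ := exists_apply_eq_smul ha.le hw hd
  have hBN : B ∈ N := by
    refine h B fun i => ?_
    have : (√M : ℂ) • B.op (u i) = (√M : ℂ) • c i • u i := by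
      rw [← map_smul, ← hwu, map_sum, smul_comm, ← hwu, Finset.smul_sum]
      exact Finset.sum_congr rfl fun m _ => hB (i, m)
    exact smul_right_injective H hsqrt this
  have hC (k : ℕ) := exists_op_eq_convexCombination B D (t := 1 / ((k : ℝ) + 1))
    ⟨by positivity, (div_le_one (by positivity)).2 (by simp)⟩
  choose C hCop using hC
  have hlim : Tendsto C atTop (𝓝 B) := by
    refine tendsto_iff.2 fun x => ?_
    have h0 := tendsto_one_div_add_atTop_nhds_zero_nat (𝕜 := ℝ)
    have h1 := ((h0.const_sub 1).smul_const (B.op x)).add (h0.smul_const (D.op x))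
    simpa [hCop] using h1
  obtain ⟨k, hkN⟩ := (hlim.eventually (hNo.mem_nhds hBN)).exists
  refine ⟨C k, hNN' hkN, fun x _ => ?_⟩
  obtain ⟨t, htk⟩ : ∃ t : ℝ, t = 1 / ((k : ℝ) + 1) := ⟨_, rfl⟩
  have ht : 0 < t := by rw [htk]; positivity
  have ht1 : t ≤ 1 := by rw [htk]; exact (div_le_one (by positivity)).2 (by simp)
  have hCop := hCop k
  rw [← htk] at hCop
  let μ : Fin n × Fin M → ℝ := fun p => (1 - t) * c p.1 + t * (a * (p.2 : ℕ) / M)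
  have hCw (p) : (C k).op (w p) = μ p • w p := by
    simp [hCop, hB, hD, μ, add_smul, mul_smul]
  have hμ (p) : μ p ∈ Icc (-a) a :=
    (convex_Icc (-a) a) (hc p.1) (hd p) (sub_nonneg.2 ht1) ht.le (by ring)
  -- Half the spacing `t * a / M` of the eigenvalues within one block, so a ball of this radius
  -- meets each block at most once. Eigenvalues of different blocks may coincide harmlessly.
  have hr : 0 < t * a / (2 * M) := by positivity
  obtain ⟨f, hf, hf1, hf0⟩ := exists_compactlySupported_one (isCompact_singleton (x := x))
    (Metric.isOpen_ball (x := x) (ε := t * a / (2 * M))) (by simpa using hr)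
  refine ⟨f, hf, by rw [hf1 x rfl]; norm_num, ?_⟩
  have hsum (i : Fin n) : ∑ m : Fin M, f (μ (i, m)) ≤ 1 := by
    by_cases hm : ∃ m, f (μ (i, m)) ≠ 0
    · obtain ⟨m, hm⟩ := hm
      rw [Finset.sum_eq_single m]
      · exact (hf _).2
      · intro m' _ hne
        by_contra hm'
        have h1 := mt (hf0 _) hm
        have h2 := mt (hf0 _) hm'
        rw [not_not, Metric.mem_ball] at h1 h2
        have h3 := (dist_triangle_right (μ (i, m)) (μ (i, m')) x).trans_lt (add_lt_add h1 h2)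
        have e : μ (i, m) - μ (i, m') = t * a / M * ((m : ℕ) - (m' : ℕ) : ℤ) := by
          simp only [μ]; push_cast; ring
        have e2 : t * a / (2 * M) + t * a / (2 * M) = t * a / M * 1 := by field_simp; norm_num
        have hp : 0 < t * a / M := by positivity
        rw [Real.dist_eq, e, e2, abs_mul, abs_of_pos hp, mul_lt_mul_iff_right₀ hp] at h3
        have h4 : |((m : ℕ) - (m' : ℕ) : ℤ)| < 1 := by exact_mod_cast h3
        rw [Int.abs_lt_one_iff] at h4
        exact hne (Fin.ext (by omega))
      · simp
    · push Not at hm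
      simp [hm]
  obtain ⟨l, rfl⟩ := (Submodule.mem_span_range_iff_exists_fun ℂ).1 hψ
  have hψw : ∑ i, l i • u i = ∑ p : Fin n × Fin M, (l p.1 * (√M : ℂ)⁻¹) • w p := by
    rw [Fintype.sum_prod_type]
    refine Finset.sum_congr rfl fun i _ => ?_
    simp only
    rw [← Finset.smul_sum, hwu, smul_smul, mul_assoc, inv_mul_cancel₀ hsqrt, mul_one]
  rw [div_lt_iff₀ hε, hu.norm_sq_sum_smul] at hM
  rw [hψw, spectralFunctional_sum hw hμ hCw, Fintype.sum_prod_type]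
  have hnorm (i : Fin n) : ‖l i * (√M : ℂ)⁻¹‖ ^ 2 = ‖l i‖ ^ 2 / M := by
    rw [norm_mul, norm_inv, Complex.norm_real, Real.norm_of_nonneg (Real.sqrt_nonneg _), mul_pow,
      inv_pow, Real.sq_sqrt hM0'.le, div_eq_mul_inv]
  simp only [hnorm, ← Finset.mul_sum]
  calc _ ≤ ∑ i, ‖l i‖ ^ 2 / M :=
        Finset.sum_le_sum fun i _ => mul_le_of_le_one_right (by positivity) (hsum i)
    _ < ε := by rw [← Finset.sum_div, div_lt_iff₀ hM0', mul_comm]; exact hM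

end SelfAdjointBall

/-! ### Bounds on spectral measures -/

section SpectralMeasure

variable {H : Type*} [NormedAddCommGroup H] [InnerProductSpace ℂ H] [CompleteSpace H]

theorem norm_cfc_le_one (A : H →L[ℂ] H) {f : C_c(ℝ, ℝ)} (hf : ∀ y, f y ∈ Icc (0 : ℝ) 1) :
    ‖cfc (fun x : ℝ => f x) A‖ ≤ 1 :=
  norm_cfc_le zero_le_one fun x _ => abs_le.2 ⟨by linarith [(hf x).1], (hf x).2⟩

/-- The bound does not depend on `f`, so the test function found for a nearby vector of the dense
sequence also serves `ψ`. -/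
theorem spectralFunctional_sub_le (A : H →L[ℂ] H) {f : C_c(ℝ, ℝ)}
    (hf : ∀ y, f y ∈ Icc (0 : ℝ) 1) (ψ φ : H) :
    spectralFunctional A ψ f - spectralFunctional A φ f ≤ (‖ψ‖ + ‖φ‖) * ‖ψ - φ‖ := by
  set T := cfc (fun x : ℝ => f x) A with hT
  have h : spectralFunctional A ψ f - spectralFunctional A φ f
      = (inner ℂ ψ (T (ψ - φ))).re + (inner ℂ (ψ - φ) (T φ)).re := by
    change (inner ℂ ψ (T ψ)).re - (inner ℂ φ (T φ)).re = _
    rw [map_sub, inner_sub_right, inner_sub_left, Complex.sub_re, Complex.sub_re]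
    ring
  have hle (x y : H) : (inner ℂ x (T y)).re ≤ ‖x‖ * ‖y‖ := by
    refine (Complex.re_le_norm _).trans ((norm_inner_le_norm _ _).trans ?_)
    gcongr
    simpa using T.le_of_opNorm_le (norm_cfc_le_one A hf) y
  rw [h]
  linarith [hle ψ (ψ - φ), hle (ψ - φ) φ]

theorem spectralFunctional_le_norm_sq (A : H →L[ℂ] H) {f : C_c(ℝ, ℝ)}
    (hf : ∀ y, f y ∈ Icc (0 : ℝ) 1) (ψ : H) : spectralFunctional A ψ f ≤ ‖ψ‖ ^ 2 := by
  have h0 : spectralFunctional A 0 f = 0 := by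
    change (inner ℂ (0 : H) _).re = 0
    simp
  have h := spectralFunctional_sub_le A hf ψ 0
  rw [h0] at h
  simpa [sq] using h

theorem spectralMeasure_univ_le (A : H →L[ℂ] H) (ψ : H) :
    spectralMeasure A ψ univ ≤ ENNReal.ofReal (‖ψ‖ ^ 2) := by
  have : (spectralMeasure A ψ).Regular := RealRMK.regular_rieszMeasure _
  rw [isOpen_univ.measure_eq_iSup_isCompact]
  refine iSup₂_le fun K _ => iSup_le fun hK => ?_
  obtain ⟨f, hf, hf1, -⟩ := exists_compactlySupported_one hK isOpen_univ (subset_univ K)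
  exact (RealRMK.rieszMeasure_le_of_eq_one _ (fun x => (hf x).1) hK hf1).trans
    (ENNReal.ofReal_le_ofReal (spectralFunctional_le_norm_sq A hf ψ))

instance instIsFiniteMeasureSpectralMeasure (A : H →L[ℂ] H) (ψ : H) :
    IsFiniteMeasure (spectralMeasure A ψ) :=
  ⟨(spectralMeasure_univ_le A ψ).trans_lt ENNReal.ofReal_lt_top⟩

end SpectralMeasure

/-! ### From the countable conditions to the spectrum -/

theorem mutuallySingular_of_forall_exists {α : Type*} [MeasurableSpace α] {μ ν : Measure α}
    [IsFiniteMeasure μ] [SigmaFinite ν]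
    (h : ∀ ε : ℝ, 0 < ε → ∃ s, μ sᶜ ≤ ENNReal.ofReal ε ∧ ν s ≤ ENNReal.ofReal ε) :
    μ.MutuallySingular ν := by
  -- A measure `ρ` below both `μ` and `ν` has total mass at most `ρ sᶜ + ρ s ≤ ε`, hence vanishes.
  refine Measure.mutuallySingular_of_disjoint fun ρ hμ hν => ?_
  refine (Measure.measure_univ_eq_zero.1 ?_).le
  refine le_antisymm (ENNReal.le_of_forall_pos_le_add fun ε hε _ => ?_) zero_le
  obtain ⟨s, h1, h2⟩ := h (ε / 2) (by positivity)
  rw [zero_add, ← compl_union_self s]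
  calc ρ (sᶜ ∪ s) ≤ ρ sᶜ + ρ s := measure_union_le _ _
    _ ≤ ENNReal.ofReal (ε / 2) + ENNReal.ofReal (ε / 2) :=
        add_le_add ((hμ _).trans h1) ((hν _).trans h2)
    _ = ε := by
        rw [← ENNReal.ofReal_add (by positivity) (by positivity), add_halves,
          ENNReal.ofReal_coe_nnreal]

namespace SelfAdjointBall

theorem exists_near_of_denseRange {H : Type*} [NormedAddCommGroup H] {d : ℕ → H} (hd : DenseRange d) (ψ : H) {ε : ℝ} (hε : 0 < ε) :
    ∃ n, (‖ψ‖ + ‖d n‖) * ‖ψ - d n‖ < ε := by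
  have hopen : IsOpen {φ : H | (‖ψ‖ + ‖φ‖) * ‖ψ - φ‖ < ε} :=
    isOpen_lt (by fun_prop) continuous_const
  exact hd.exists_mem_open hopen ⟨ψ, by simpa using hε⟩

variable {H : Type*} [NormedAddCommGroup H] [InnerProductSpace ℂ H] [CompleteSpace H] {a : ℝ}

theorem norm_le_of_mem_spectrum (A : SelfAdjointBall H a) {𝕜 : Type*} [NormedField 𝕜]
    [NormedAlgebra 𝕜 (H →L[ℂ] H)] {x : 𝕜} (hx : x ∈ spectrum 𝕜 A.op) : ‖x‖ ≤ a := by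
  cases subsingleton_or_nontrivial H
  · simp [spectrum.of_subsingleton] at hx
  · exact (spectrum.norm_le_norm_of_mem hx).trans A.norm_op_le

theorem mem_smallAtoms_of_denseRange {A : SelfAdjointBall H a} {d : ℕ → H} (hd : DenseRange d)
    (h : ∀ n, ∀ ε > 0, A ∈ smallAtoms a (d n) ε) (ψ : H) {ε : ℝ} (hε : 0 < ε) :
    A ∈ smallAtoms a ψ ε := by
  intro x hx
  obtain ⟨n, hn⟩ := exists_near_of_denseRange hd ψ (half_pos hε)
  obtain ⟨f, hf, hfx, hfA⟩ := h n _ (half_pos hε) x hx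
  exact ⟨f, hf, hfx, by linarith [spectralFunctional_sub_le A.op hf ψ (d n)]⟩

theorem mem_nearlySingular_of_denseRange {A : SelfAdjointBall H a} {d : ℕ → H}
    (hd : DenseRange d) (h : ∀ n, ∀ ε > 0, A ∈ nearlySingular a (d n) ε) (ψ : H) {ε : ℝ}
    (hε : 0 < ε) : A ∈ nearlySingular a ψ ε := by
  obtain ⟨n, hn⟩ := exists_near_of_denseRange hd ψ (ε := ε / 3) (by positivity)
  obtain ⟨f, hf, hfi, hfA⟩ := h n (ε / 3) (by positivity)
  refine ⟨f, hf, by linarith, ?_⟩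
  have h1 := spectralFunctional_sub_le A.op hf (d n) ψ
  rw [add_comm, norm_sub_rev] at h1
  have h2 : ‖ψ‖ ^ 2 - ‖d n‖ ^ 2 ≤ (‖ψ‖ + ‖d n‖) * ‖ψ - d n‖ := by
    rw [sq_sub_sq]
    gcongr
    exact norm_sub_norm_le _ _
  linarith

theorem spectralMeasure_singleton_eq_zero {A : SelfAdjointBall H a} {ψ : H}
    (h : ∀ ε > 0, A ∈ smallAtoms a ψ ε) (x : ℝ) : spectralMeasure A.op ψ {x} = 0 := by
  by_cases hx : x ∈ Icc (-a) a
  · refine le_antisymm (ENNReal.le_of_forall_pos_le_add fun ε hε _ => ?_) zero_le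
    obtain ⟨f, hf, hfx, hfA⟩ := h (ε / 2) (by positivity) x hx
    -- Normalizing `f` to be `1` at `x` costs a factor less than `2`, absorbed by the choice of `ε /
    -- 2`.
    have hle := RealRMK.rieszMeasure_le_of_eq_one (spectralFunctional A.op ψ) (f := (f x)⁻¹ • f)
      (fun y => mul_nonneg (inv_nonneg.2 (hf x).1) (hf y).1) (isCompact_singleton (x := x))
      (by rintro y rfl; exact inv_mul_cancel₀ (by linarith))
    refine hle.trans ?_
    rw [zero_add, map_smul, ← ENNReal.ofReal_coe_nnreal]
    refine ENNReal.ofReal_le_ofReal ?_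
    rw [smul_eq_mul, inv_mul_le_iff₀ (by linarith)]
    nlinarith [NNReal.coe_pos.2 hε]
  · obtain ⟨f, hf, hf1, hf0⟩ := exists_compactlySupported_one (isCompact_singleton (x := x))
      (isClosed_Icc (a := -a) (b := a)).isOpen_compl (by simpa using hx)
    have hle := RealRMK.rieszMeasure_le_of_eq_one (spectralFunctional A.op ψ)
      (fun y => (hf y).1) isCompact_singleton hf1
    have hzero : spectralFunctional A.op ψ f = 0 := by
      have : cfc (fun y : ℝ => f y) A.op = cfc (fun _ : ℝ => (0 : ℝ)) A.op :=
        cfc_congr fun y hy => hf0 y fun hc => hc (abs_le.1 (A.norm_le_of_mem_spectrum hy))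
      change (inner ℂ ψ (cfc (fun y : ℝ => f y) A.op ψ)).re = 0
      rw [this, cfc_const_zero]
      simp
    rw [hzero, ENNReal.ofReal_zero] at hle
    exact le_antisymm hle zero_le

theorem mutuallySingular_spectralMeasure {A : SelfAdjointBall H a} {ψ : H}
    (h : ∀ ε > 0, A ∈ nearlySingular a ψ ε) :
    (spectralMeasure A.op ψ).MutuallySingular volume := by
  refine mutuallySingular_of_forall_exists fun ε hε => ?_
  obtain ⟨f, hf, hfi, hfA⟩ := h (ε / 2) (by positivity)
  have hint (μ : Measure ℝ) [IsFiniteMeasureOnCompacts μ] : Integrable f μ :=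
    f.continuous.integrable_of_hasCompactSupport f.hasCompactSupport
  -- Markov's inequality at level `1 / 2`, applied to `f` for Lebesgue measure and to `1 - f` for
  -- the spectral measure.
  have key (μ : Measure ℝ) {g : ℝ → ℝ} (hg : Integrable g μ) (hg0 : ∀ x, 0 ≤ g x)
      (hlt : ∫ x, g x ∂μ < ε / 2) : μ {x | 1 / 2 ≤ g x} ≤ ENNReal.ofReal ε := by
    have h1 := mul_meas_ge_le_integral_of_nonneg (Eventually.of_forall hg0) hg (1 / 2)
    have h2 : μ {x | 1 / 2 ≤ g x} ≠ ⊤ :=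
      (hg.measure_ge_lt_top (by norm_num : (0 : ℝ) < 1 / 2)).ne
    rw [← ENNReal.ofReal_toReal h2]
    refine ENNReal.ofReal_le_ofReal ?_
    change 1 / 2 * (μ {x | 1 / 2 ≤ g x}).toReal ≤ _ at h1
    linarith
  refine ⟨{x | 1 / 2 ≤ f x}, ?_, key volume (hint _) (fun x => (hf x).1) hfi⟩
  refine (measure_mono fun x hx => ?_).trans (key (spectralMeasure A.op ψ) (g := fun x => 1 - f x)
    ((integrable_const 1).sub (hint _)) (fun x => sub_nonneg.2 (hf x).2) ?_)
  · have : ¬ 1 / 2 ≤ f x := hx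
    change 1 / 2 ≤ 1 - f x
    linarith
  · rw [integral_sub (integrable_const 1) (hint _), integral_spectralMeasure, integral_const,
      smul_eq_mul, mul_one]
    have : (spectralMeasure A.op ψ).real univ ≤ ‖ψ‖ ^ 2 :=
      ENNReal.toReal_le_of_le_ofReal (sq_nonneg _) (spectralMeasure_univ_le _ _)
    refine lt_of_le_of_lt ?_ hfA
    exact sub_le_sub_right this _

/-- An inverse of `c - A` would bound `‖A x - c x‖` away from zero over unit vectors. -/
theorem mem_spectrum_of_approxEigenvalue {A : SelfAdjointBall H a} {c : ℝ}
    (h : ∀ ε > 0, A ∈ approxEigenvalue H c ε) : (c : ℂ) ∈ spectrum ℂ A.op := by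
  rw [spectrum.mem_iff]
  rintro ⟨U, hU⟩
  obtain ⟨x, hx, hlt⟩ := h (‖(↑U⁻¹ : H →L[ℂ] H)‖ + 1)⁻¹ (by positivity)
  have hUx : (U : H →L[ℂ] H) x = -(A.op x - c • x) := by
    rw [hU]
    simp [Algebra.algebraMap_eq_smul_one]
  have hx' : (↑U⁻¹ : H →L[ℂ] H) ((U : H →L[ℂ] H) x) = x := by
    rw [← mul_apply_eq_comp, Units.inv_mul]
    rfl
  have hle := (↑U⁻¹ : H →L[ℂ] H).le_opNorm ((U : H →L[ℂ] H) x)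
  rw [hx', hx, hUx, norm_neg] at hle
  rw [lt_inv_comm₀ (norm_pos_iff.2 fun h0 => ?_) (by positivity)] at hlt
  · have hpos : 0 < ‖A.op x - c • x‖ := by
      by_contra hn
      rw [le_antisymm (not_lt.1 hn) (norm_nonneg _)] at hle
      linarith
    rw [lt_inv_comm₀ (by positivity) hpos, ← one_div, lt_div_iff₀ (by positivity)] at hlt
    nlinarith
  · rw [h0] at hle
    simp at hle
    linarith

theorem spectrum_eq_of_denseRange {A : SelfAdjointBall H a} {d : ℕ → Icc (-a) a}
    (hd : DenseRange d) (h : ∀ n, ∀ ε > 0, A ∈ approxEigenvalue H (d n) ε) :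
    spectrum ℂ A.op = (fun t : ℝ => (t : ℂ)) '' Icc (-a) a := by
  refine Subset.antisymm (fun z hz => ⟨z.re, ?_, ?_⟩) ?_
  · exact abs_le.1 ((Complex.abs_re_le_norm z).trans (A.norm_le_of_mem_spectrum hz))
  · exact (A.isSelfAdjoint_op.mem_spectrum_eq_re hz).symm
  · rintro _ ⟨t, ht, rfl⟩
    have hclosed : IsClosed {s : Icc (-a) a | ((s : ℝ) : ℂ) ∈ spectrum ℂ A.op} :=
      (spectrum.isClosed (𝕜 := ℂ) A.op).preimage
        (Complex.continuous_ofReal.comp continuous_subtype_val)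
    have hsub : range d ⊆ {s : Icc (-a) a | ((s : ℝ) : ℂ) ∈ spectrum ℂ A.op} := by
      rintro _ ⟨n, rfl⟩
      exact mem_spectrum_of_approxEigenvalue (h n)
    exact hclosed.closure_subset_iff.2 hsub (hd ⟨t, ht⟩)

theorem exists_index_of_pos {P : ℝ → Prop} (hP : ∀ ε δ, ε ≤ δ → P ε → P δ)
    (h : ∀ k : ℕ, P (1 / ((k : ℝ) + 1))) (ε : ℝ) (hε : 0 < ε) : P ε := by
  obtain ⟨k, hk⟩ := exists_nat_one_div_lt hε
  exact hP _ _ hk.le (h k)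

end SelfAdjointBall

open SelfAdjointBall in
theorem theorem3 {H : Type*} [NormedAddCommGroup H] [InnerProductSpace ℂ H] [CompleteSpace H]
    [TopologicalSpace.SeparableSpace H] (hH : ¬ FiniteDimensional ℂ H) (a : ℝ) (ha : 0 < a) :
    ∃ S : Set (SelfAdjointBall H a), IsGδ S ∧ Dense S ∧
      ∀ A ∈ S, spectrum ℂ A.op = (fun t : ℝ => (t : ℂ)) '' Set.Icc (-a) a ∧
        HasPurelySingularContinuousSpectrum A.op := by
  let d := TopologicalSpace.denseSeq H
  have hd : DenseRange d := TopologicalSpace.denseRange_denseSeq H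
  have : Nonempty (Icc (-a) a) := ⟨⟨0, by simp [ha.le]⟩⟩
  let c := TopologicalSpace.denseSeq (Icc (-a) a)
  have hc : DenseRange c := TopologicalSpace.denseRange_denseSeq _
  -- The first index runs through both dense sequences at once, the second through the tolerances.
  let W (p : ℕ × ℕ) : Set (SelfAdjointBall H a) :=
    smallAtoms a (d p.1) (1 / ((p.2 : ℝ) + 1)) ∩ nearlySingular a (d p.1) (1 / ((p.2 : ℝ) + 1)) ∩
      approxEigenvalue H (c p.1) (1 / ((p.2 : ℝ) + 1))
  have hopen (p) : IsOpen (W p) :=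
    ((isOpen_smallAtoms _ _).inter (isOpen_nearlySingular _ _)).inter (isOpen_approxEigenvalue _ _)
  have hdense (p) : Dense (W p) := by
    have hp : 0 < 1 / ((p.2 : ℝ) + 1) := by positivity
    exact ((dense_smallAtoms hH ha _ hp).inter_of_isOpen_left (dense_nearlySingular ha.le _ hp)
      (isOpen_smallAtoms _ _)).inter_of_isOpen_left (dense_approxEigenvalue hH (c p.1).2 hp)
      ((isOpen_smallAtoms _ _).inter (isOpen_nearlySingular _ _))
  refine ⟨⋂ p, W p, .iInter_of_isOpen hopen, dense_iInter_of_isOpen hopen hdense,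
    fun A hA => ?_⟩
  rw [mem_iInter] at hA
  have h1 (n : ℕ) : ∀ ε > 0, A ∈ smallAtoms a (d n) ε :=
    exists_index_of_pos (fun ε δ hεδ h x hx => by
      obtain ⟨f, hf, hfx, hfA⟩ := h x hx
      exact ⟨f, hf, hfx, hfA.trans_le hεδ⟩) fun k => (hA (n, k)).1.1
  have h2 (n : ℕ) : ∀ ε > 0, A ∈ nearlySingular a (d n) ε :=
    exists_index_of_pos (fun ε δ hεδ ⟨f, hf, hfi, hfA⟩ =>
      ⟨f, hf, hfi.trans_le hεδ, hfA.trans_le hεδ⟩) fun k => (hA (n, k)).1.2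
  have h3 (n : ℕ) : ∀ ε > 0, A ∈ approxEigenvalue H (c n) ε :=
    exists_index_of_pos (fun ε δ hεδ ⟨x, hx, hlt⟩ => ⟨x, hx, hlt.trans_le hεδ⟩)
      fun k => (hA (n, k)).2
  exact ⟨spectrum_eq_of_denseRange hc h3, fun ψ =>
    ⟨spectralMeasure_singleton_eq_zero fun ε hε => mem_smallAtoms_of_denseRange hd h1 ψ hε,
      mutuallySingular_spectralMeasure fun ε hε => mem_nearlySingular_of_denseRange hd h2 ψ hε⟩⟩
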